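/- Let $G$ be a 3-dimensional real Lie group that is unimodular, i.e. $\operatorname{tr}(\operatorname{ad} X)=0$ for every $X$ in its Lie algebra, and let $T$ be a left-invariant symmetric $(0,2)$-tensor field on $G$. Suppose that $T\neq 0$, and that it is not the case that both $T$ has signature $(+,-,-)$ and $G$ is locally isomorphic to $SO(3)$ (i.e. the Lie algebra of $G$ is isomorphic to $\mathfrak{so}(3)$). Then there is at most one real constant $c>0$ for which there exists a left-invariant Riemannian metric $g$ on $G$ whose Ricci curvature satisfies $\mathrm{Ric}(g)=cT$. -/

import Mathlib

open Bundle
open scoped Manifold ContDiff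

noncomputable section

namespace LeftInvariantRicci

/-- A `C^∞` real Lie group is regular enough for Mathlib's Lie algebra structure on
`GroupLieAlgebra I G = T₁G`. -/
instance instLieGroupMinSmoothness
    {E : Type*} [NormedAddCommGroup E] [NormedSpace ℝ E]
    {H : Type*} [TopologicalSpace H] {I : ModelWithCorners ℝ E H}
    {G : Type*} [TopologicalSpace G] [ChartedSpace H G] [Group G] [LieGroup I ∞ G] :
    LieGroup I (minSmoothness ℝ 3) G :=
  LieGroup.of_le (n := ∞) (by
    simp only [minSmoothness_of_isRCLikeNormedField]
    exact ENat.LEInfty.out)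

section Manifold

variable {E : Type*} [NormedAddCommGroup E] [NormedSpace ℝ E]
  {H : Type*} [TopologicalSpace H] (I : ModelWithCorners ℝ E H)
  (M : Type*) [TopologicalSpace M] [ChartedSpace H M]

/-- Fields of (continuous) bilinear forms on the tangent spaces, i.e. `(0,2)` tensor fields. -/
abbrev TensorField02 : Type _ :=
  Π x : M, TangentSpace I x →L[ℝ] TangentSpace I x →L[ℝ] ℝ

/-- Smooth (`C^∞`) Riemannian metrics on the manifold `M`. -/
abbrev SmoothMetric [IsManifold I ∞ M] : Type _ :=
  ContMDiffRiemannianMetric I ∞ E (TangentSpace I : M → Type _)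

variable {I M} [IsManifold I ∞ M]

/-- `X` is a smooth (`C^∞`) vector field. -/
def IsSmoothField (X : Π x : M, TangentSpace I x) : Prop :=
  ContMDiff I I.tangent ∞ (fun x ↦ (⟨x, X x⟩ : TangentBundle I M))

/-- `∇` is compatible with `g`: `v (g(Y, Z)) = g(∇_v Y, Z) + g(Y, ∇_v Z)` for every point `x`,
every `v ∈ T_x M` and all vector fields `Y`, `Z` that are differentiable at `x`
(in Mathlib `cov Y x v` is the value of `∇_v Y`). -/
def IsMetricConnection (g : SmoothMetric I M)
    (cov : CovariantDerivative I E (TangentSpace I : M → Type _)) : Prop :=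
  ∀ (x : M) (v : TangentSpace I x) (Y Z : Π y : M, TangentSpace I y),
    MDifferentiableAt I I.tangent (fun y ↦ (⟨y, Y y⟩ : TangentBundle I M)) x →
    MDifferentiableAt I I.tangent (fun y ↦ (⟨y, Z y⟩ : TangentBundle I M)) x →
    mfderiv I 𝓘(ℝ, ℝ) (fun y ↦ g.inner y (Y y) (Z y)) x v
      = g.inner x (cov Y x v) (Z x) + g.inner x (Y x) (cov Z x v)

/-- `∇` is the Levi-Civita connection of `g`: it is torsion-free and compatible with `g`. -/
def IsLeviCivita [FiniteDimensional ℝ E] [CompleteSpace E] (g : SmoothMetric I M)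
    (cov : CovariantDerivative I E (TangentSpace I : M → Type _)) : Prop :=
  cov.torsion = 0 ∧ IsMetricConnection g cov

/-- The curvature `R(X, Y) Z = ∇_X ∇_Y Z - ∇_Y ∇_X Z - ∇_{[X, Y]} Z`. -/
def curvature (cov : CovariantDerivative I E (TangentSpace I : M → Type _))
    (X Y Z : Π x : M, TangentSpace I x) (x : M) : TangentSpace I x :=
  cov (fun y ↦ cov Z y (Y y)) x (X x) - cov (fun y ↦ cov Z y (X y)) x (Y x)
    - cov Z x (VectorField.mlieBracket I X Y x)

/-- `Ric` is the Ricci tensor of `∇`: for all smooth vector fields `Y`, `Z` and every point `x`,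
`Ric(Y, Z)` at `x` is the trace of the endomorphism `X ↦ R(X, Y) Z` of `T_x M`. -/
def IsRicciTensor
    (cov : CovariantDerivative I E (TangentSpace I : M → Type _))
    (Ric : TensorField02 I M) : Prop :=
  ∀ Y Z : Π x : M, TangentSpace I x, IsSmoothField Y → IsSmoothField Z → ∀ x : M,
    ∃ A : TangentSpace I x →ₗ[ℝ] TangentSpace I x,
      (∀ X : Π x : M, TangentSpace I x, IsSmoothField X → A (X x) = curvature cov X Y Z x) ∧
      Ric x (Y x) (Z x) = LinearMap.trace ℝ (TangentSpace I x) A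

/-- `Ric(g) = S`: the tensor field `S` is the Ricci curvature of the metric `g`. -/
def HasRicciCurvature [FiniteDimensional ℝ E] [CompleteSpace E]
    (g : SmoothMetric I M) (S : TensorField02 I M) : Prop :=
  ∃ cov : CovariantDerivative I E (TangentSpace I : M → Type _),
    IsLeviCivita g cov ∧ IsRicciTensor cov S

end Manifold

section Group

variable {E : Type*} [NormedAddCommGroup E] [NormedSpace ℝ E]
  {H : Type*} [TopologicalSpace H] {I : ModelWithCorners ℝ E H}
  {G : Type*} [TopologicalSpace G] [ChartedSpace H G] [Group G]

/-- A `(0,2)` tensor field on `G` is left-invariant if every left translation preserves it. -/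
def IsLeftInvariant (T : TensorField02 I G) : Prop :=
  ∀ (a x : G) (u v : TangentSpace I x),
    T (a * x) (mfderiv I I (fun y : G ↦ a * y) x u) (mfderiv I I (fun y : G ↦ a * y) x v)
      = T x u v

/-- A `(0,2)` tensor field is symmetric if it is a symmetric form on every tangent space. -/
def IsSymmetric (T : TensorField02 I G) : Prop :=
  ∀ (x : G) (u v : TangentSpace I x), T x u v = T x v u

variable (I G) in
/-- Unimodularity of a Lie group, expressed on its Lie algebra: `tr (ad X) = 0` for all `X`. -/
def IsUnimodular [CompleteSpace E] [LieGroup I ∞ G] : Prop :=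
  ∀ X : GroupLieAlgebra I G, LinearMap.trace ℝ (GroupLieAlgebra I G)
    (LieAlgebra.ad ℝ (GroupLieAlgebra I G) X) = 0

variable (I G) in
/-- The Lie algebra of `G` is isomorphic to `so(3)`, i.e. `G` is locally isomorphic to `SO(3)`. -/
def IsLocallySO3 [CompleteSpace E] [LieGroup I ∞ G] : Prop :=
  Nonempty (GroupLieAlgebra I G ≃ₗ⁅ℝ⁆ LieAlgebra.Orthogonal.so (Fin 3) ℝ)

/-- The value of `T` at the identity, as a quadratic form on the Lie algebra. -/
def quadraticFormAtOne (T : TensorField02 I G) : QuadraticForm ℝ (GroupLieAlgebra I G) :=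
  LinearMap.BilinMap.toQuadraticMap (ContinuousLinearMap.toLinearMap₁₂ (T 1))

/-- A left-invariant `T` on a 3-dimensional group has signature `(+,-,-)`. -/
def HasSignaturePosNegNeg (T : TensorField02 I G) : Prop :=
  sigPos (quadraticFormAtOne T) = 1 ∧ sigNeg (quadraticFormAtOne T) = 2

end Group

end LeftInvariantRicci

end

/-! Unimodularity makes the structure matrix in an orthonormal frame symmetric, so it can be
diagonalised (`exists_milnorFrame`). In the resulting frame ⁅e i, e (i+1)⁆ = (μ i + μ (i+1)) e
(i+2), and Ric is diagonal with entries 2 μ (i+1) μ (i+2) (`HasRicciCurvature.isMilnorRicci`). The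
problem is now algebraic.

Let cT and dT be the Ricci forms of two metrics, with data μ and ν, t = d/c, and A the change of
frame. Write L for the diagonal matrix of structure constants and R for that of Ric. Then det A ·
L_μ = A L_ν Aᵀ and t Aᵀ R_μ A = R_ν, so L_ν R_ν is similar to t det A · L_μ R_μ. Hence the ratios y
i = (μ (i+1) + μ (i+2)) / μ i of the two frames agree up to order and a common factor k, and k = 1
forces t = 1 (`IsMilnorTransition.exists_scale`). The identity y₀y₁y₂ = 2 + y₀ + y₁ + y₂ holds in
both frames, so k = 1 or y₀y₁y₂(k² + k) = -2 (`scale_dichotomy`).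

Up to rotation and a global sign, the μ are all positive, or have signs (+,-,-), or satisfy μ₀ = 0
with μ₁, μ₂ nonzero. If all are positive, the second alternative fails by signs. For (+,-,-) it
leaves two possibilities: y₁, y₂ > 0, where all structure constants are negative and the algebra is
the excluded so(3); or all y negative, where a monotonicity argument gives k = 1
(`scale_eq_one_of_separated`). If μ₀ = 0, a 2×2 determinant gives t = 1 directly
(`IsMilnorTransition.eq_one_of_zero`). -/

namespace LeftInvariantRicci
open Module Matrix

/-! ### Milnor frames of unimodular Lie algebras -/

section LieAlg
variable {𝔤 : Type*} [LieRing 𝔤] [LieAlgebra ℝ 𝔤]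

/-- `e` is a Milnor frame with connection coefficients `μ`: the bracket is
`⁅e₁, e₂⁆ = (μ₁ + μ₂) e₃` and its cyclic permutations. -/
def IsMilnorFrame (e : Basis (Fin 3) ℝ 𝔤) (μ : Fin 3 → ℝ) : Prop :=
  ∀ i, ⁅e i, e (i + 1)⁆ = (μ i + μ (i + 1)) • e (i + 2)

/-- The Ricci form of the metric for which the Milnor frame is orthonormal. -/
def IsMilnorRicci (e : Basis (Fin 3) ℝ 𝔤) (μ : Fin 3 → ℝ) (B : LinearMap.BilinForm ℝ 𝔤) : Prop :=
  ∀ i j, B (e i) (e j) = if i = j then 2 * μ (i + 1) * μ (i + 2) else 0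

theorem exists_orthonormal_basis (h3 : finrank ℝ 𝔤 = 3) (q : LinearMap.BilinForm ℝ 𝔤)
    (hs : ∀ u v, q u v = q v u) (hp : ∀ v, v ≠ 0 → 0 < q v v) :
    ∃ b : Basis (Fin 3) ℝ 𝔤, ∀ i j, q (b i) (b j) = if i = j then 1 else 0 := by
  have : FiniteDimensional ℝ 𝔤 := FiniteDimensional.of_finrank_pos (by omega)
  obtain ⟨v, hv⟩ := LinearMap.BilinForm.exists_orthogonal_basis (B := q)
    ⟨fun u v ↦ by simp [hs u v]⟩
  let v' := v.reindex (finCongr h3)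
  have hv' : ∀ i j, i ≠ j → q (v' i) (v' j) = 0 := by
    intro i j hij
    simp only [v', Basis.reindex_apply]
    exact hv (by simpa using hij)
  have hpos : ∀ i, 0 < q (v' i) (v' i) := fun i ↦ hp _ (v'.ne_zero i)
  have hne : ∀ i, Real.sqrt (q (v' i) (v' i)) ≠ 0 := fun i ↦ (Real.sqrt_pos.2 (hpos i)).ne'
  refine ⟨v'.unitsSMul fun i ↦ (Units.mk0 _ (hne i))⁻¹, fun i j ↦ ?_⟩
  simp only [Basis.unitsSMul_apply, Units.smul_def, Units.val_inv_eq_inv_val, Units.val_mk0,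
    map_smul, LinearMap.smul_apply, smul_eq_mul]
  split_ifs with hij
  · subst hij
    have := Real.mul_self_sqrt (hpos i).le
    have h1 := hne i
    field_simp
    rw [pow_two, this]
  · rw [hv' i j hij]; simp

/-- Entrywise: the cross product of two rows of an orthogonal matrix is ± the third row. -/
theorem adjugate_of_orthonormal (P : Matrix (Fin 3) (Fin 3) ℝ) (h : P * Pᵀ = 1) :
    P.adjugate = P.det • Pᵀ :=
  calc P.adjugate = P.adjugate * (P * Pᵀ) := by rw [h, mul_one]
    _ = P.det • Pᵀ := by rw [← mul_assoc, adjugate_mul, smul_mul_assoc, one_mul]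

/-- The bracket of two combinations of a basis through the structure matrix. -/
theorem lie_sum_basis (b : Basis (Fin 3) ℝ 𝔤) (S : Fin 3 → 𝔤)
    (hS : ∀ i, ⁅b (i + 1), b (i + 2)⁆ = S i) (u v : Fin 3 → ℝ) :
    ⁅∑ i, u i • b i, ∑ i, v i • b i⁆ =
      ∑ i, (u (i + 1) * v (i + 2) - u (i + 2) * v (i + 1)) • S i := by
  have h0 := hS 0
  have h1 := hS 1
  have h2 := hS 2
  have e1 : (1 : Fin 3) + 1 = 2 := rfl
  have e2 : (1 : Fin 3) + 2 = 0 := rfl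
  have e3 : (2 : Fin 3) + 1 = 0 := rfl
  have e4 : (2 : Fin 3) + 2 = 1 := rfl
  have h0' : ⁅b 2, b 1⁆ = - S 0 := by rw [← lie_skew, ← h0]; rfl
  have h1' : ⁅b 0, b 2⁆ = - S 1 := by rw [← lie_skew, ← h1]; rfl
  have h2' : ⁅b 1, b 0⁆ = - S 2 := by rw [← lie_skew, ← h2]; rfl
  simp only [zero_add, e1, e2, e3, e4] at h0 h1 h2
  simp only [Fin.sum_univ_three, add_lie, lie_add, smul_lie, lie_smul, lie_self, h0, h1, h2, h0',
    h1', h2', zero_add, e1, e2, e3, e4]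
  module

theorem exists_milnorFrame (h3 : finrank ℝ 𝔤 = 3)
    (huni : ∀ X : 𝔤, LinearMap.trace ℝ 𝔤 (LieAlgebra.ad ℝ 𝔤 X) = 0)
    (q : LinearMap.BilinForm ℝ 𝔤)
    (hs : ∀ u v, q u v = q v u) (hp : ∀ v, v ≠ 0 → 0 < q v v) :
    ∃ (e : Basis (Fin 3) ℝ 𝔤) (μ : Fin 3 → ℝ),
      (∀ i j, q (e i) (e j) = if i = j then 1 else 0) ∧ IsMilnorFrame e μ := by
  obtain ⟨b, hb⟩ := exists_orthonormal_basis h3 q hs hp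
  let S : Matrix (Fin 3) (Fin 3) ℝ := Matrix.of fun i k ↦ b.repr ⁅b (i + 1), b (i + 2)⁆ k
  have hSk : ∀ i, ⁅b (i + 1), b (i + 2)⁆ = ∑ k, S i k • b k := fun i ↦ (b.sum_repr _).symm
  have hherm : S.IsHermitian := by
    -- The trace of ad (b i) is S (i+2) (i+1) - S (i+1) (i+2).
    have key : ∀ i, S (i + 1) (i + 2) = S (i + 2) (i + 1) := by
      intro i
      have := huni (b i)
      rw [LinearMap.trace_eq_matrix_trace ℝ b, Matrix.trace] at this
      simp only [Matrix.diag, LinearMap.toMatrix_apply, LieAlgebra.ad_apply] at this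
      have hsum : ∀ f : Fin 3 → ℝ, ∑ j, f j = f i + f (i + 1) + f (i + 2) := by
        intro f; fin_cases i <;> simp [Fin.sum_univ_three] <;> ring
      rw [hsum, lie_self, ← lie_skew] at this
      have a1 : i + 1 + 1 = i + 2 := by fin_cases i <;> rfl
      have a2 : i + 1 + 2 = i := by fin_cases i <;> rfl
      have a3 : i + 2 + 1 = i := by fin_cases i <;> rfl
      have a4 : i + 2 + 2 = i + 1 := by fin_cases i <;> rfl
      simp only [S, Matrix.of_apply, a1, a2, a3, a4]
      rw [← lie_skew (b (i + 2)) (b i)]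
      rw [← lie_skew (b i) (b (i + 1))]
      simp only [map_neg, map_zero, Finsupp.neg_apply, Finsupp.zero_apply] at this ⊢
      have e1 := congrArg (fun x ↦ (b.repr x) (i + 1)) (lie_skew (b i) (b (i + 1)))
      simp only [map_neg, Finsupp.neg_apply] at e1
      linarith
    ext i j
    simp only [conjTranspose_apply, star_trivial]
    have k0 : S 1 2 = S 2 1 := key 0
    have k1 : S 2 0 = S 0 2 := key 1
    have k2 : S 0 1 = S 1 0 := key 2
    fin_cases i <;> fin_cases j <;> simp [k0, k1, k2]
  let w := hherm.eigenvectorBasis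
  let P : Matrix (Fin 3) (Fin 3) ℝ := Matrix.of fun i j ↦ w i j
  have hPP : P * Pᵀ = 1 := by
    ext i j
    have := orthonormal_iff_ite.1 w.orthonormal i j
    rw [PiLp.inner_apply] at this
    rw [Matrix.mul_apply, Matrix.one_apply, ← this]
    refine Finset.sum_congr rfl fun k _ ↦ ?_
    simp [P, mul_comm]
  have heig : ∀ i k, ∑ l, P i l * S l k = hherm.eigenvalues i * P i k := by
    intro i k
    have := congrFun (hherm.mulVec_eigenvectorBasis i) k
    simp only [Matrix.mulVec, dotProduct, Pi.smul_apply, smul_eq_mul] at this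
    refine Eq.trans (Finset.sum_congr rfl fun l _ ↦ ?_) this
    have := hherm.apply k l
    rw [star_trivial] at this
    rw [this, mul_comm]
    rfl
  have hadj := adjugate_of_orthonormal P hPP
  let e' : Fin 3 → 𝔤 := fun i ↦ ∑ j, P i j • b j
  have hq : ∀ i j, q (e' i) (e' j) = if i = j then 1 else 0 := by
    intro i j
    have := congrFun (congrFun hPP i) j
    rw [Matrix.mul_apply, Matrix.one_apply] at this
    rw [← this]
    simp [e', hb, mul_comm]
  have hli : LinearIndependent ℝ e' := by
    rw [Fintype.linearIndependent_iff]
    intro g hg i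
    have := congrArg (fun x ↦ q x (e' i)) hg
    simpa [hq] using this
  let e : Basis (Fin 3) ℝ 𝔤 := basisOfLinearIndependentOfCardEqFinrank hli (by simp [h3])
  have he : ∀ i, e i = e' i := fun i ↦ by simp [e]
  have hbr : ∀ i, ⁅e' i, e' (i + 1)⁆ = (P.det * hherm.eigenvalues (i + 2)) • e' (i + 2) := by
    intro i
    have hc : ∀ l, P i (l + 1) * P (i + 1) (l + 2) - P i (l + 2) * P (i + 1) (l + 1)
        = P.det * P (i + 2) l := by
      intro l
      have := congrFun (congrFun hadj l) (i + 2)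
      simp only [Matrix.smul_apply, transpose_apply, smul_eq_mul] at this
      rw [← this, adjugate_fin_three]
      fin_cases i <;> fin_cases l <;> simp <;> ring
    simp only [e']
    rw [lie_sum_basis b _ hSk]
    simp only [hc, Finset.smul_sum, smul_smul]
    rw [Finset.sum_comm]
    refine Finset.sum_congr rfl fun k _ ↦ ?_
    rw [← Finset.sum_smul, mul_assoc, ← heig, Finset.mul_sum]
    simp only [mul_assoc]
  -- These values solve μ i + μ (i+1) = det P · eigenvalue (i+2). The sign det P is absorbed into μ,
  -- so no orientation has to be chosen.
  refine ⟨e, fun i ↦ P.det * ((hherm.eigenvalues 0 + hherm.eigenvalues 1 + hherm.eigenvalues 2) / 2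
    - hherm.eigenvalues i), by simpa [he] using hq, fun i ↦ ?_⟩
  rw [he, he, he, hbr]
  congr 1
  fin_cases i <;> simp <;> ring

end LieAlg
end LeftInvariantRicci

noncomputable section

namespace LeftInvariantRicci
open Module

/-! ### Levi-Civita connection and Ricci form in left-invariant fields -/

section Geometry
variable {E : Type*} [NormedAddCommGroup E] [NormedSpace ℝ E]
  {H : Type*} [TopologicalSpace H] {I : ModelWithCorners ℝ E H}
  {G : Type*} [TopologicalSpace G] [ChartedSpace H G] [Group G] [LieGroup I ∞ G]

/-- The value at x is the derivative of multiplication at (x, 1) applied to (0, v), which exhibits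
the field as a composite of smooth maps of tangent bundles. -/
theorem isSmoothField_mulInvariantVectorField (v : GroupLieAlgebra I G) :
    IsSmoothField (I := I) (mulInvariantVectorField v : Π x : G, TangentSpace I x) := by
  let fg : G → TangentBundle I G := fun g ↦ TotalSpace.mk' E g 0
  have sfg : CMDiff ∞ fg := contMDiff_zeroSection _ _
  let fv : G → TangentBundle I G := fun _ ↦ TotalSpace.mk' E 1 v
  have sfv : CMDiff ∞ fv := contMDiff_const
  let F₁ : G → (TangentBundle I G × TangentBundle I G) := fun g ↦ (fg g, fv g)
  have S₁ : CMDiff ∞ F₁ := sfg.prodMk sfv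
  let F₂ : (TangentBundle I G × TangentBundle I G) → TangentBundle (I.prod I) (G × G) :=
    (equivTangentBundleProd I G I G).symm
  have S₂ : CMDiff ∞ F₂ := contMDiff_equivTangentBundleProd_symm
  let F₃ : TangentBundle (I.prod I) (G × G) → TangentBundle I G :=
    tangentMap% (fun (p : G × G) ↦ p.1 * p.2)
  have S₃ : CMDiff ∞ F₃ := by
    apply ContMDiff.contMDiff_tangentMap _ (m := ∞) le_rfl
    exact contMDiff_mul I ∞
  let S := (S₃.comp S₂).comp S₁
  unfold IsSmoothField
  convert! S with g
  · simp [F₁, F₂, F₃, fg, fv]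
  · simp only [Function.comp_apply, tangentMap, F₃, F₂, F₁, fg, fv]
    rw [mfderiv_prod_eq_add_apply ((contMDiff_mul I ∞).mdifferentiableAt (by simp))]
    have h0 : mfderiv I I (fun z : G ↦ z * 1) g 0 = 0 := map_zero _
    let b : E := mfderiv I I (fun z : G ↦ g * z) 1 v
    exact ((congrArg (fun w : E ↦ w + b) h0).trans (zero_add b)).symm

omit [LieGroup I ∞ G] in
theorem IsLeftInvariant.apply_mulInvariantVectorField {T : TensorField02 I G}
    (hT : IsLeftInvariant T) (u v : GroupLieAlgebra I G) (x : G) :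
    T x (mulInvariantVectorField u x) (mulInvariantVectorField v x) = T 1 u v := by
  -- Left invariance gives the value at x * 1. All tangent spaces are the same `E`, so the base
  -- point can be replaced along an arbitrary equality.
  have key : ∀ y, y = x → T x (mfderiv I I (fun z : G ↦ x * z) 1 u : E)
      (mfderiv I I (fun z : G ↦ x * z) 1 v : E) = T y (mfderiv I I (fun z : G ↦ x * z) 1 u : E)
      (mfderiv I I (fun z : G ↦ x * z) 1 v : E) := by
    rintro _ rfl; rfl
  exact (key _ (mul_one x)).trans (hT x 1 u v)



theorem eq_sum_mulInvariantVectorField (h3 : finrank ℝ E = 3) {g : SmoothMetric I G}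
    (hg : IsLeftInvariant (I := I) (G := G) g.inner) {e : Fin 3 → GroupLieAlgebra I G}
    (he : ∀ i j, g.inner 1 (e i) (e j) = if i = j then 1 else 0) (x : G) (w : TangentSpace I x) :
    w = ∑ k, g.inner x w (mulInvariantVectorField (e k) x) • mulInvariantVectorField (e k) x := by
  have hx : ∀ i j, g.inner x (mulInvariantVectorField (e i) x) (mulInvariantVectorField (e j) x)
      = if i = j then 1 else 0 := fun i j ↦ by
    rw [hg.apply_mulInvariantVectorField, he]
  have hli : LinearIndependent ℝ (fun i ↦ mulInvariantVectorField (e i) x) := by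
    rw [Fintype.linearIndependent_iff]
    intro c hc i
    have := congrArg (fun z ↦ g.inner x z (mulInvariantVectorField (e i) x)) hc
    simpa [hx] using this
  have h3' : finrank ℝ (TangentSpace I x) = 3 := h3
  let b := basisOfLinearIndependentOfCardEqFinrank hli (by simp [h3'])
  have hb : ∀ i, b i = mulInvariantVectorField (e i) x := fun i ↦ by simp [b]
  have hw := b.sum_repr w
  simp only [hb] at hw
  have hr : ∀ k, g.inner x w (mulInvariantVectorField (e k) x) = b.repr w k := by
    intro k
    conv_lhs => rw [← hw]
    simp [hx]
  simp only [hr, hw]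

/-- Milnor's formulas for the Levi-Civita connection of a left-invariant metric. -/
theorem IsLeviCivita.cov_apply [FiniteDimensional ℝ E] [CompleteSpace E]
    (h3 : finrank ℝ E = 3) {g : SmoothMetric I G}
    {cov : CovariantDerivative I E (TangentSpace I : G → Type _)}
    (hg : IsLeftInvariant (I := I) (G := G) g.inner)
    (h : IsLeviCivita g cov) {e : Basis (Fin 3) ℝ (GroupLieAlgebra I G)} {μ : Fin 3 → ℝ}
    (he : ∀ i j, g.inner 1 (e i) (e j) = if i = j then 1 else 0)
    (hμ : IsMilnorFrame e μ) (x : G) (i : Fin 3) :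
    cov (mulInvariantVectorField (e i)) x (mulInvariantVectorField (e i) x) = 0 ∧
    cov (mulInvariantVectorField (e (i + 1))) x (mulInvariantVectorField (e i) x) =
      μ i • mulInvariantVectorField (e (i + 2)) x ∧
    cov (mulInvariantVectorField (e i)) x (mulInvariantVectorField (e (i + 1)) x) =
      (-μ (i + 1)) • mulInvariantVectorField (e (i + 2)) x := by
  have hdiff : ∀ v : GroupLieAlgebra I G, MDifferentiableAt I I.tangent
      (fun y ↦ (⟨y, mulInvariantVectorField v y⟩ : TangentBundle I G)) x := fun v ↦
    (isSmoothField_mulInvariantVectorField v).mdifferentiable (by simp) x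
  let Γ : Fin 3 → Fin 3 → Fin 3 → ℝ := fun i j k ↦ g.inner x
    (cov (mulInvariantVectorField (e j)) x (mulInvariantVectorField (e i) x))
    (mulInvariantVectorField (e k) x)
  have hΓ : ∀ i j, cov (mulInvariantVectorField (e j)) x (mulInvariantVectorField (e i) x)
      = ∑ k, Γ i j k • mulInvariantVectorField (e k) x := fun i j ↦
    eq_sum_mulInvariantVectorField h3 hg he x _
  have hx : ∀ i j, g.inner x (mulInvariantVectorField (e i) x) (mulInvariantVectorField (e j) x)
      = if i = j then 1 else 0 := fun i j ↦ by
    rw [hg.apply_mulInvariantVectorField, he]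
  have hskew : ∀ i j k, Γ i j k = - Γ i k j := by
    intro i j k
    have := h.2 x (mulInvariantVectorField (e i) x) _ _ (hdiff (e j)) (hdiff (e k))
    have hc : (fun y : G ↦ g.inner y (mulInvariantVectorField (e j) y)
        (mulInvariantVectorField (e k) y)) = fun _ ↦ g.inner 1 (e j) (e k) :=
      funext fun y ↦ hg.apply_mulInvariantVectorField _ _ y
    rw [hc, mfderiv_const] at this
    have h1 := g.symm x (mulInvariantVectorField (e j) x)
      (cov (mulInvariantVectorField (e k)) x (mulInvariantVectorField (e i) x))
    rw [h1] at this
    have h2 : (0 : ℝ) = Γ i j k + Γ i k j := this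
    linarith
  have htor : ∀ i k, Γ i (i + 1) k - Γ (i + 1) i k
      = (μ i + μ (i + 1)) * if i + 2 = k then 1 else 0 := by
    intro i k
    have h1 := cov.torsion_eq_zero_iff.1 h.1 (hdiff (e i)) (hdiff (e (i + 1)))
    have h2 : VectorField.mlieBracket I (mulInvariantVectorField (e i))
        (mulInvariantVectorField (e (i + 1))) x =
        (μ i + μ (i + 1)) • mulInvariantVectorField (e (i + 2)) x := by
      rw [← mulInvariantVector_mlieBracket, ← GroupLieAlgebra.bracket_def, hμ i,
        mulInvariantVectorField_smul]
      rfl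
    rw [h2] at h1
    have := congrArg (fun z ↦ g.inner x z (mulInvariantVectorField (e k) x)) h1
    simpa [hx, Γ] using this
  have e1 : (1 : Fin 3) + 1 = 2 := rfl
  have e2 : (1 : Fin 3) + 2 = 0 := rfl
  have e3 : (2 : Fin 3) + 1 = 0 := rfl
  have e4 : (2 : Fin 3) + 2 = 1 := rfl
  -- Skewness in the last two indices and the torsion identity form a linear system that determines
  -- Γ: Koszul's formula in this frame.
  have hval : ∀ i, Γ i i i = 0 ∧ Γ i i (i + 1) = 0 ∧ Γ i i (i + 2) = 0 ∧
      Γ i (i + 1) i = 0 ∧ Γ i (i + 1) (i + 1) = 0 ∧ Γ i (i + 1) (i + 2) = μ i ∧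
      Γ (i + 1) i i = 0 ∧ Γ (i + 1) i (i + 1) = 0 ∧ Γ (i + 1) i (i + 2) = - μ (i + 1) := by
    have t00 := htor 0 0
    have t01 := htor 0 1
    have t02 := htor 0 2
    have t10 := htor 1 0
    have t11 := htor 1 1
    have t12 := htor 1 2
    have t20 := htor 2 0
    have t21 := htor 2 1
    have t22 := htor 2 2
    simp [e1, e2, e3, e4] at t00 t01 t02 t10 t11 t12 t20 t21 t22
    intro i
    fin_cases i <;> simp only [Fin.zero_eta, Fin.mk_one, Fin.reduceFinMk, zero_add, e1, e2, e3, e4] <;>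
    · have s0 := fun a ↦ hskew a 0 0
      have s1 := fun a ↦ hskew a 1 1
      have s2 := fun a ↦ hskew a 2 2
      have s3 := fun a ↦ hskew a 0 1
      have s4 := fun a ↦ hskew a 0 2
      have s5 := fun a ↦ hskew a 1 2
      refine ⟨?_, ?_, ?_, ?_, ?_, ?_, ?_, ?_, ?_⟩ <;>
        linarith [s0 0, s0 1, s0 2, s1 0, s1 1, s1 2, s2 0, s2 1, s2 2, s3 0, s3 1, s3 2,
          s4 0, s4 1, s4 2, s5 0, s5 1, s5 2]
  have hsum : ∀ f : Fin 3 → TangentSpace I x, ∑ j, f j = f i + f (i + 1) + f (i + 2) := by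
    intro f; fin_cases i <;> simp [Fin.sum_univ_three, e1, e2, e3, e4] <;> abel
  obtain ⟨v1, v2, v3, v4, v5, v6, v7, v8, v9⟩ := hval i
  refine ⟨?_, ?_, ?_⟩ <;> rw [hΓ, hsum] <;> simp only [v1, v2, v3, v4, v5, v6, v7, v8, v9] <;> simp

/-- The connection coefficients `∇_{e_i} e_j = ∑ k, milnorGamma μ i j k • e_k` in a Milnor frame. -/
def milnorGamma (μ : Fin 3 → ℝ) (i j k : Fin 3) : ℝ :=
  if j = i + 1 ∧ k = i + 2 then μ i else if j = i + 2 ∧ k = i + 1 then -μ i else 0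

theorem IsLeviCivita.cov_apply_eq_sum [FiniteDimensional ℝ E] [CompleteSpace E]
    (h3 : finrank ℝ E = 3) {g : SmoothMetric I G}
    {cov : CovariantDerivative I E (TangentSpace I : G → Type _)}
    (hg : IsLeftInvariant (I := I) (G := G) g.inner)
    (h : IsLeviCivita g cov) {e : Basis (Fin 3) ℝ (GroupLieAlgebra I G)} {μ : Fin 3 → ℝ}
    (he : ∀ i j, g.inner 1 (e i) (e j) = if i = j then 1 else 0)
    (hμ : IsMilnorFrame e μ) (i j : Fin 3) (x : G) :
    cov (mulInvariantVectorField (e j)) x (mulInvariantVectorField (e i) x) =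
      mulInvariantVectorField (∑ k, milnorGamma μ i j k • e k) x := by
  have e1 : (1 : Fin 3) + 1 = 2 := rfl
  have e2 : (1 : Fin 3) + 2 = 0 := rfl
  have e3 : (2 : Fin 3) + 1 = 0 := rfl
  have e4 : (2 : Fin 3) + 2 = 1 := rfl
  have hc := h.cov_apply h3 hg he hμ x
  obtain ⟨h00, h01, h10⟩ := hc 0
  obtain ⟨h11, h12, h21⟩ := hc 1
  obtain ⟨h22, h20, h02⟩ := hc 2
  simp only [zero_add, e1, e2, e3, e4] at h00 h01 h10 h11 h12 h21 h22 h20 h02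
  have hz : mulInvariantVectorField (I := I) (0 : GroupLieAlgebra I G) x = 0 :=
    map_zero (mfderiv I I (fun z : G ↦ x * z) 1)
  fin_cases i <;> fin_cases j <;>
    simp [milnorGamma, e1, e2, e3, e4, h00, h01, h10, h11, h12, h21, h22, h20, h02,
      mulInvariantVectorField_smul, hz, -neg_smul]

theorem CovariantDerivative.apply_mulInvariantVectorField_sum [FiniteDimensional ℝ E]
    (cov : CovariantDerivative I E (TangentSpace I : G → Type _)) {ι : Type*} [Fintype ι]
    (c : ι → ℝ) (e : ι → GroupLieAlgebra I G) (x : G) :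
    cov (mulInvariantVectorField (∑ k, c k • e k)) x =
      ∑ k, c k • cov (mulInvariantVectorField (e k)) x := by
  have hdiff : ∀ v : GroupLieAlgebra I G, MDifferentiableAt I I.tangent
      (fun y ↦ (⟨y, mulInvariantVectorField v y⟩ : TangentBundle I G)) x := fun v ↦
    (isSmoothField_mulInvariantVectorField v).mdifferentiable (by simp) x
  let D : GroupLieAlgebra I G →ₗ[ℝ] (TangentSpace I x →L[ℝ] TangentSpace I x) :=
    { toFun := fun v ↦ cov (mulInvariantVectorField v) x
      map_add' := fun u v ↦ by
        rw [mulInvariantVectorField_add]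
        exact cov.isCovariantDerivativeOnUniv.add (hdiff u) (hdiff v)
      map_smul' := fun a v ↦ by
        rw [mulInvariantVectorField_smul]
        exact cov.isCovariantDerivativeOnUniv.smul_const a (hdiff v) }
  have := map_sum D (fun k ↦ c k • e k) Finset.univ
  simp only [map_smul] at this
  exact this

/-- Covariant derivatives of frame fields along frame fields are again left-invariant with constant
coefficients `milnorGamma`, and zero torsion expresses the brackets through the same constants.
Curvature at 1 is then a polynomial in them, and its trace is taken in the basis e. -/
theorem HasRicciCurvature.isMilnorRicci [FiniteDimensional ℝ E] [CompleteSpace E]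
    (h3 : finrank ℝ E = 3) {g : SmoothMetric I G} {S : TensorField02 I G}
    (hg : IsLeftInvariant (I := I) (G := G) g.inner)
    (h : HasRicciCurvature g S) {e : Basis (Fin 3) ℝ (GroupLieAlgebra I G)} {μ : Fin 3 → ℝ}
    (he : ∀ i j, g.inner 1 (e i) (e j) = if i = j then 1 else 0)
    (hμ : IsMilnorFrame e μ) :
    IsMilnorRicci e μ (ContinuousLinearMap.toLinearMap₁₂ (S 1)) := by
  obtain ⟨cov, hLC, hRic⟩ := h
  have hone : ∀ v : GroupLieAlgebra I G, mulInvariantVectorField v 1 = v := fun v ↦ by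
    have : (fun y : G ↦ 1 * y) = id := by ext y; simp
    unfold mulInvariantVectorField
    rw [this, mfderiv_id]; rfl
  have hcov := fun i j ↦ hLC.cov_apply_eq_sum h3 hg he hμ i j
  have hcov' : ∀ i j, cov (mulInvariantVectorField (e j)) 1 (e i) =
      ∑ k, milnorGamma μ i j k • e k := fun i j ↦ by
    have := hcov i j 1
    rwa [hone, hone] at this
  have hsm := fun i ↦ isSmoothField_mulInvariantVectorField (I := I) (e i)
  have hbr : ∀ i j, ⁅e i, e j⁆ = ∑ l, (milnorGamma μ i j l - milnorGamma μ j i l) • e l := by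
    intro i j
    have h1 := cov.torsion_eq_zero_iff.1 hLC.1 ((hsm i).mdifferentiable (by simp) 1)
      ((hsm j).mdifferentiable (by simp) 1)
    rw [hone, hone, hcov', hcov', ← GroupLieAlgebra.bracket_def] at h1
    rw [← h1]
    simp [sub_smul]
  have hcurv : ∀ i j k, curvature cov (mulInvariantVectorField (e i))
      (mulInvariantVectorField (e j)) (mulInvariantVectorField (e k)) 1 =
      ∑ m, (∑ l, (milnorGamma μ j k l * milnorGamma μ i l m - milnorGamma μ i k l *
        milnorGamma μ j l m - (milnorGamma μ i j l - milnorGamma μ j i l) *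
        milnorGamma μ l k m)) • e m := by
    intro i j k
    unfold curvature
    have hf : ∀ a b : Fin 3, (fun y ↦ cov (mulInvariantVectorField (e b)) y
        (mulInvariantVectorField (e a) y)) =
        mulInvariantVectorField (∑ k, milnorGamma μ a b k • e k) := fun a b ↦ funext (hcov a b)
    have hlin : ∀ c : Fin 3 → ℝ, cov (mulInvariantVectorField (e k)) 1 (∑ l, c l • e l) =
        ∑ l, c l • cov (mulInvariantVectorField (e k)) 1 (e l) := fun c ↦ by
      have := map_sum (cov (mulInvariantVectorField (e k)) 1 :
        GroupLieAlgebra I G →L[ℝ] GroupLieAlgebra I G) (fun l ↦ c l • e l) Finset.univ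
      simp only [map_smul] at this
      exact this
    rw [hf, hf, CovariantDerivative.apply_mulInvariantVectorField_sum,
      CovariantDerivative.apply_mulInvariantVectorField_sum, ← GroupLieAlgebra.bracket_def,
      hone, hone, hbr, hlin]
    simp only [sum_apply, smul_apply, hcov', Finset.smul_sum, smul_smul,
      Finset.sum_smul, sub_smul, Finset.sum_sub_distrib]
    exact congrArg₂ _ (congrArg₂ _ Finset.sum_comm Finset.sum_comm) Finset.sum_comm
  intro i j
  obtain ⟨A, hA, hS⟩ := hRic _ _ (hsm i) (hsm j) 1
  rw [hone, hone] at hS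
  refine hS.trans ?_
  have htr := LinearMap.trace_eq_matrix_trace ℝ e A
  refine htr.trans ?_
  have hAe : ∀ k, e.repr (A (e k)) k = ∑ l, (milnorGamma μ i j l * milnorGamma μ k l k -
      milnorGamma μ k j l * milnorGamma μ i l k - (milnorGamma μ k i l - milnorGamma μ i k l) *
      milnorGamma μ l j k) := fun k ↦ by
    have := hA _ (hsm k)
    rw [hone, hcurv] at this
    refine (congrArg (fun z ↦ e.repr z k) this).trans ?_
    simp [Finsupp.single_apply]
  simp only [Matrix.trace, Matrix.diag, LinearMap.toMatrix_apply]
  refine (Finset.sum_congr rfl fun k _ ↦ hAe k).trans ?_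
  have e1 : (1 : Fin 3) + 1 = 2 := rfl
  have e2 : (1 : Fin 3) + 2 = 0 := rfl
  have e3 : (2 : Fin 3) + 1 = 0 := rfl
  have e4 : (2 : Fin 3) + 2 = 1 := rfl
  fin_cases i <;> fin_cases j <;>
    simp [milnorGamma, Fin.sum_univ_three, e1, e2, e3, e4] <;> ring

theorem exists_milnorFrame_of_metric [FiniteDimensional ℝ E] [CompleteSpace E]
    (h3 : finrank ℝ E = 3) (hG : IsUnimodular I G) (g : SmoothMetric I G) :
    ∃ (e : Basis (Fin 3) ℝ (GroupLieAlgebra I G)) (μ : Fin 3 → ℝ),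
      (∀ i j, g.inner 1 (e i) (e j) = if i = j then 1 else 0) ∧ IsMilnorFrame e μ :=
  exists_milnorFrame h3 hG (ContinuousLinearMap.toLinearMap₁₂ (g.inner 1)) (g.symm 1) (g.pos 1)

/-- The fields extending an orthonormal frame span every tangent space, so a left-invariant tensor
is determined at 1. -/
theorem IsLeftInvariant.eq_zero (h3 : finrank ℝ E = 3) {g : SmoothMetric I G}
    (hg : IsLeftInvariant (I := I) (G := G) g.inner) {e : Fin 3 → GroupLieAlgebra I G}
    (he : ∀ i j, g.inner 1 (e i) (e j) = if i = j then 1 else 0) {T : TensorField02 I G}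
    (hT : IsLeftInvariant T) (h1 : ContinuousLinearMap.toLinearMap₁₂ (T 1) = 0) : T = 0 := by
  have h1' : ∀ u v : GroupLieAlgebra I G, T 1 u v = 0 := fun u v ↦
    congrArg (fun B : LinearMap.BilinForm ℝ (GroupLieAlgebra I G) ↦ B u v) h1
  ext x u v
  rw [eq_sum_mulInvariantVectorField h3 hg he x u, eq_sum_mulInvariantVectorField h3 hg he x v]
  simp [sum_apply, hT.apply_mulInvariantVectorField, h1']

end Geometry
end LeftInvariantRicci

end

namespace LeftInvariantRicci
open Module Matrix

/-! ### Signature of a diagonal form -/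

section Signature
variable {V : Type*} [AddCommGroup V] [Module ℝ V]

theorem sigPos_sigNeg_of_diagonal (B : LinearMap.BilinForm ℝ V) (e : Basis (Fin 3) ℝ V)
    (hoff : ∀ i j, i ≠ j → B (e i) (e j) = 0) (h0 : 0 < B (e 0) (e 0)) (h1 : B (e 1) (e 1) < 0)
    (h2 : B (e 2) (e 2) < 0) :
    sigPos (LinearMap.BilinMap.toQuadraticMap B) = 1 ∧
      sigNeg (LinearMap.BilinMap.toQuadraticMap B) = 2 := by
  have heq : (LinearMap.BilinMap.toQuadraticMap B).Equivalent
      (QuadraticMap.weightedSumSquares ℝ fun i ↦ B (e i) (e i)) := by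
    refine ⟨⟨e.equivFun, fun m ↦ ?_⟩⟩
    have hm : B m m = ∑ i, B (e i) (e i) * (e.repr m i * e.repr m i) := by
      conv_lhs => rw [← e.sum_repr m]
      simp only [Fin.sum_univ_three]
      simp [hoff]
      ring
    simp [hm]
  rw [QuadraticForm.sigPos_of_equiv_weightedSumSquares heq,
    QuadraticForm.sigNeg_of_equiv_weightedSumSquares heq]
  have hp : {i | 0 < B (e i) (e i)} = {0} := by
    ext i; fin_cases i <;> simp [h0, h1.le, h2.le]
  have hn : {i | B (e i) (e i) < 0} = {1, 2} := by
    ext i; fin_cases i <;> simp [h0.le, h1, h2]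
  rw [hp, hn]
  exact ⟨by simp, Set.ncard_pair (by decide)⟩

end Signature

/-! ### Recognising so(3) -/

section SO3

/-- The matrix of `x ×₃ ·`. -/
def crossMatrix (x : Fin 3 → ℝ) : Matrix (Fin 3) (Fin 3) ℝ :=
  !![0, -x 2, x 1; x 2, 0, -x 0; -x 1, x 0, 0]

/-- `ℝ³` as the space of skew-symmetric matrices. -/
def crossMatrixEquiv : (Fin 3 → ℝ) ≃ₗ[ℝ] LieAlgebra.Orthogonal.so (Fin 3) ℝ where
  toFun x := ⟨crossMatrix x, by
    rw [LieAlgebra.Orthogonal.mem_so]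
    ext i j; fin_cases i <;> fin_cases j <;> simp [crossMatrix]⟩
  map_add' x y := by
    ext i j; fin_cases i <;> fin_cases j <;> simp [crossMatrix] <;> ring
  map_smul' c x := by
    ext i j; fin_cases i <;> fin_cases j <;> simp [crossMatrix]
  invFun A := ![A.1 2 1, A.1 0 2, A.1 1 0]
  left_inv x := by ext i; fin_cases i <;> simp [crossMatrix]
  right_inv A := by
    have h := (LieAlgebra.Orthogonal.mem_so _ _ A.1).1 A.2
    have hij : ∀ i j, A.1 j i = - A.1 i j := fun i j ↦ congrFun (congrFun h i) j
    have hii : ∀ i, A.1 i i = 0 := fun i ↦ by linarith [hij i i]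
    ext i j
    fin_cases i <;> fin_cases j <;>
      simp [crossMatrix, hii, hij 1 0, hij 2 1, hij 0 2]

theorem crossMatrixEquiv_coe (x : Fin 3 → ℝ) :
    (crossMatrixEquiv x : Matrix (Fin 3) (Fin 3) ℝ) = crossMatrix x := rfl

variable {𝔤 : Type*} [LieRing 𝔤] [LieAlgebra ℝ 𝔤]

theorem nonempty_lieEquiv_so_of_cyclic (e : Basis (Fin 3) ℝ 𝔤)
    (he : ∀ i, ⁅e (i + 1), e (i + 2)⁆ = e i) :
    Nonempty (𝔤 ≃ₗ⁅ℝ⁆ LieAlgebra.Orthogonal.so (Fin 3) ℝ) := by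
  let φ : 𝔤 ≃ₗ[ℝ] LieAlgebra.Orthogonal.so (Fin 3) ℝ := e.equivFun.trans crossMatrixEquiv
  refine ⟨{ φ with map_lie' := ?_ }⟩
  intro u v
  change φ ⁅u, v⁆ = ⁅φ u, φ v⁆
  have h1 : ⁅u, v⁆ = ∑ i, (e.equivFun u (i + 1) * e.equivFun v (i + 2) -
      e.equivFun u (i + 2) * e.equivFun v (i + 1)) • e i := by
    conv_lhs => rw [← e.sum_equivFun u, ← e.sum_equivFun v]
    exact lie_sum_basis e e he _ _
  have h2 : e.equivFun ⁅u, v⁆ = fun i ↦ (e.equivFun u (i + 1) * e.equivFun v (i + 2) -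
      e.equivFun u (i + 2) * e.equivFun v (i + 1)) := by
    rw [h1, ← e.equivFun_symm_apply, LinearEquiv.apply_symm_apply]
  simp only [φ, LinearEquiv.trans_apply, h2]
  generalize e.equivFun u = x
  generalize e.equivFun v = y
  apply Subtype.ext
  change (crossMatrixEquiv _).1 =
    (crossMatrixEquiv x).1 * (crossMatrixEquiv y).1 -
      (crossMatrixEquiv y).1 * (crossMatrixEquiv x).1
  simp only [crossMatrixEquiv_coe]
  have e1 : (1 : Fin 3) + 1 = 2 := rfl
  have e2 : (1 : Fin 3) + 2 = 0 := rfl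
  have e3 : (2 : Fin 3) + 1 = 0 := rfl
  have e4 : (2 : Fin 3) + 2 = 1 := rfl
  ext i j
  fin_cases i <;> fin_cases j <;>
    simp [crossMatrix, e1, e2, e3, e4] <;> ring

/-- Rescaling the frame by inverse square roots of the absolute structure constants makes them all
1; the minus sign in the factors corrects their common negative sign. -/
theorem IsMilnorFrame.nonempty_lieEquiv_so {e : Basis (Fin 3) ℝ 𝔤} {μ : Fin 3 → ℝ}
    (h : IsMilnorFrame e μ) (hneg : ∀ i, μ i + μ (i + 1) < 0) :
    Nonempty (𝔤 ≃ₗ⁅ℝ⁆ LieAlgebra.Orthogonal.so (Fin 3) ℝ) := by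
  let l : Fin 3 → ℝ := fun i ↦ -(μ (i + 1) + μ (i + 2))
  have a1 : ∀ i : Fin 3, i + 1 + 1 = i + 2 := by decide
  have a2 : ∀ i : Fin 3, i + 1 + 2 = i := by decide
  have a3 : ∀ i : Fin 3, i + 2 + 1 = i := by decide
  have a4 : ∀ i : Fin 3, i + 2 + 2 = i + 1 := by decide
  have hl : ∀ i, 0 < l i := fun i ↦ by
    have := hneg (i + 1)
    rw [a1] at this
    simp only [l]; linarith
  have hs : ∀ i, 0 < Real.sqrt (l i) := fun i ↦ Real.sqrt_pos.2 (hl i)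
  have hne : ∀ i, -(Real.sqrt (l (i + 1)) * Real.sqrt (l (i + 2)))⁻¹ ≠ 0 := fun i ↦
    neg_ne_zero.2 (inv_ne_zero (mul_pos (hs _) (hs _)).ne')
  let e' := e.unitsSMul fun i ↦ Units.mk0 _ (hne i)
  have he' : ∀ i, e' i = (-(Real.sqrt (l (i + 1)) * Real.sqrt (l (i + 2)))⁻¹) • e i := fun i ↦ by
    simp [e', Basis.unitsSMul_apply, Units.smul_def]
  refine nonempty_lieEquiv_so_of_cyclic e' fun i ↦ ?_
  have hb := h (i + 1)
  rw [a1, a2] at hb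
  have hli : μ (i + 1) + μ (i + 2) = - (Real.sqrt (l i) * Real.sqrt (l i)) := by
    rw [Real.mul_self_sqrt (hl i).le]; simp [l]
  rw [he', he', he', smul_lie, lie_smul, hb, smul_smul, smul_smul, hli, a1, a2, a3, a4]
  congr 1
  have h0 := (hs i).ne'
  have h1 := (hs (i + 1)).ne'
  have h2 := (hs (i + 2)).ne'
  field_simp

end SO3
end LeftInvariantRicci

namespace LeftInvariantRicci
open Module Matrix

/-! ### Scalar equations for the Milnor ratios -/

section Scalar

theorem scale_dichotomy {p s k : ℝ} (h : p = 2 + s) (h' : k ^ 3 * p = 2 + k * s) :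
    k = 1 ∨ p * (k ^ 2 + k) + 2 = 0 := by
  have : (k - 1) * (p * (k ^ 2 + k) + 2) = 0 := by
    have : s = p - 2 := by linarith
    subst this; linarith
  rcases mul_eq_zero.1 this with h | h
  · left; linarith
  · right; exact h

/-- Division by the product of the 1 - z turns the cubic relation into ∑ 1/(1 - z) = 1. Subtracting
the two instances leaves k - 1 times a sum of terms z / ((1 - z)(1 - k z)), each positive because z
and k z lie on the same side of 1. -/
theorem scale_eq_one_of_same_side {z₀ z₁ z₂ k : ℝ} (h0 : 0 < z₀) (h1 : 0 < z₁) (h2 : 0 < z₂)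
    (h : z₀ + z₁ + z₂ = 2 + z₀ * z₁ * z₂)
    (h' : k * z₀ + k * z₁ + k * z₂ = 2 + (k * z₀) * (k * z₁) * (k * z₂))
    (s0 : 0 < (1 - z₀) * (1 - k * z₀)) (s1 : 0 < (1 - z₁) * (1 - k * z₁))
    (s2 : 0 < (1 - z₂) * (1 - k * z₂)) : k = 1 := by
  have a0 : 1 - z₀ ≠ 0 := left_ne_zero_of_mul s0.ne'
  have a1 : 1 - z₁ ≠ 0 := left_ne_zero_of_mul s1.ne'
  have a2 : 1 - z₂ ≠ 0 := left_ne_zero_of_mul s2.ne'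
  have b0 : 1 - k * z₀ ≠ 0 := right_ne_zero_of_mul s0.ne'
  have b1 : 1 - k * z₁ ≠ 0 := right_ne_zero_of_mul s1.ne'
  have b2 : 1 - k * z₂ ≠ 0 := right_ne_zero_of_mul s2.ne'
  have key : ∀ x y w : ℝ, 1 - x ≠ 0 → 1 - y ≠ 0 → 1 - w ≠ 0 → x + y + w = 2 + x * y * w →
      1 / (1 - x) + 1 / (1 - y) + 1 / (1 - w) = 1 := by
    intro x y w hx hy hw hh
    field_simp
    linear_combination -hh
  have e1 := key _ _ _ a0 a1 a2 h
  have e2 := key _ _ _ b0 b1 b2 h'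
  have d : ∀ z, 1 - z ≠ 0 → 1 - k * z ≠ 0 →
      1 / (1 - k * z) - 1 / (1 - z) = (k - 1) * (z / ((1 - z) * (1 - k * z))) := by
    intro z hz hz'
    field_simp
    ring
  have hsum : (k - 1) * (z₀ / ((1 - z₀) * (1 - k * z₀)) + z₁ / ((1 - z₁) * (1 - k * z₁)) +
      z₂ / ((1 - z₂) * (1 - k * z₂))) = 0 := by
    linear_combination e2 - e1 - d z₀ a0 b0 - d z₁ a1 b1 - d z₂ a2 b2
  have hpos := add_pos (add_pos (div_pos h0 s0) (div_pos h1 s1)) (div_pos h2 s2)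
  rcases mul_eq_zero.1 hsum with h | h
  · linarith
  · exact absurd h hpos.ne'

/-- The case of eigenvalue triples `-z` and `-k z` in which the first frame vector is separated
from the other two by the value `1`. -/
theorem scale_eq_one_of_separated {z₀ z₁ z₂ k m₀ m₁ m₂ n₀ n₁ n₂ : ℝ} (hk : 0 < k)
    (h0 : 0 < z₀) (h1 : 0 < z₁) (h2 : 0 < z₂)
    (h : z₀ + z₁ + z₂ = 2 + z₀ * z₁ * z₂)
    (h' : k * z₀ + k * z₁ + k * z₂ = 2 + (k * z₀) * (k * z₁) * (k * z₂))
    (m0 : 0 < m₀) (m1 : m₁ < 0) (m2 : m₂ < 0) (n0 : 0 < n₀) (n1 : n₁ < 0) (n2 : n₂ < 0)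
    (hm1 : m₀ * (1 - z₀) = m₁ * (1 - z₁)) (hm2 : m₀ * (1 - z₀) = m₂ * (1 - z₂))
    (hn1 : n₀ * (1 - k * z₀) = n₁ * (1 - k * z₁)) (hn2 : n₀ * (1 - k * z₀) = n₂ * (1 - k * z₂)) :
    k = 1 := by
  have pos : ∀ {a b x y : ℝ}, 0 < a → b < 0 → a * x = b * y → (0 < x → y < 0) ∧ (x < 0 → 0 < y) ∧
      (x = 0 → y = 0) := by
    intro a b x y ha hb hxy
    refine ⟨fun hx ↦ ?_, fun hx ↦ ?_, fun hx ↦ ?_⟩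
    · by_contra hy
      nlinarith [mul_pos ha hx, mul_nonneg (neg_pos.2 hb).le (not_lt.1 hy)]
    · by_contra hy
      nlinarith [mul_pos ha (neg_pos.2 hx), mul_nonneg (neg_pos.2 hb).le (neg_nonneg.2 (not_lt.1 hy))]
    · rw [hx, mul_zero] at hxy
      rcases mul_eq_zero.1 hxy.symm with h | h
      · exact absurd h hb.ne
      · exact h
  obtain ⟨p1, q1, r1⟩ := pos m0 m1 hm1
  obtain ⟨p2, q2, r2⟩ := pos m0 m2 hm2
  obtain ⟨p1', q1', r1'⟩ := pos n0 n1 hn1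
  obtain ⟨p2', q2', r2'⟩ := pos n0 n2 hn2
  -- The value 1 separates z₀ from z₁ and z₂, and likewise after multiplication by k. As k > 0
  -- preserves the order, each z and k z fall on the same side.
  rcases lt_trichotomy (1 - z₀) 0 with c | c | c
  · have y1 := q1 c
    have y2 := q2 c
    have hlt : k * z₁ < k * z₀ := mul_lt_mul_of_pos_left (by linarith) hk
    have c' : 1 - k * z₀ < 0 := by
      by_contra hc
      rcases (not_lt.1 hc).eq_or_lt with hc | hc
      · have := r1' hc.symm; linarith
      · have := p1' hc; linarith
    exact scale_eq_one_of_same_side h0 h1 h2 h h' (mul_pos_of_neg_of_neg c c')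
      (mul_pos y1 (q1' c')) (mul_pos y2 (q2' c'))
  · have y1 := r1 c
    have y2 := r2 c
    have z0 : z₀ = 1 := by linarith
    have z1 : z₁ = 1 := by linarith
    have z2 : z₂ = 1 := by linarith
    subst z0 z1 z2
    have : (k - 1) ^ 2 * (k + 2) = 0 := by linarith
    rcases mul_eq_zero.1 this with h | h
    · linarith [pow_eq_zero_iff (two_ne_zero) |>.1 h]
    · linarith
  · have y1 := p1 c
    have y2 := p2 c
    have hlt : k * z₀ < k * z₁ := mul_lt_mul_of_pos_left (by linarith) hk
    have c' : 0 < 1 - k * z₀ := by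
      by_contra hc
      rcases (not_lt.1 hc).eq_or_lt with hc | hc
      · have := r1' hc; linarith
      · have := q1' hc; linarith
    exact scale_eq_one_of_same_side h0 h1 h2 h h' (mul_pos c c')
      (mul_pos_of_neg_of_neg y1 (p1' c')) (mul_pos_of_neg_of_neg y2 (p2' c'))

/-- Ratio of the structure constant to the connection coefficient in a Milnor frame. -/
noncomputable def milnorRatio (μ : Fin 3 → ℝ) (i : Fin 3) : ℝ := (μ (i + 1) + μ (i + 2)) / μ i

theorem milnorRatio_prod {μ : Fin 3 → ℝ} (h : ∀ i, μ i ≠ 0) :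
    milnorRatio μ 0 * milnorRatio μ 1 * milnorRatio μ 2 =
      2 + (milnorRatio μ 0 + milnorRatio μ 1 + milnorRatio μ 2) := by
  have h0 := h 0
  have h1 := h 1
  have h2 := h 2
  have e1 : (1 : Fin 3) + 1 = 2 := rfl
  have e2 : (1 : Fin 3) + 2 = 0 := rfl
  have e3 : (2 : Fin 3) + 1 = 0 := rfl
  have e4 : (2 : Fin 3) + 2 = 1 := rfl
  simp only [milnorRatio, zero_add, e1, e2, e3, e4]
  field_simp
  ring

/-- The common value on the right ties the sign of 1 + y i to that of μ i; this supplies the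
separation by 1 for z = -y. -/
theorem mul_one_add_milnorRatio {μ : Fin 3 → ℝ} (h : ∀ i, μ i ≠ 0) (i : Fin 3) :
    μ i * (1 + milnorRatio μ i) = μ 0 + μ 1 + μ 2 := by
  have h0 := h i
  have : μ i * (1 + milnorRatio μ i) = μ i + μ (i + 1) + μ (i + 2) := by
    simp only [milnorRatio]; field_simp; ring
  rw [this]
  fin_cases i
  · rfl
  · change μ 1 + μ 2 + μ 0 = _; ring
  · change μ 2 + μ 0 + μ 1 = _; ring

/-- Scalar core of uniqueness for signature `(+,-,-)`. -/
theorem scale_eq_one_of_pos_neg_neg {μ ν : Fin 3 → ℝ} {k : ℝ}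
    (m0 : 0 < μ 0) (m1 : μ 1 < 0) (m2 : μ 2 < 0) (n0 : 0 < ν 0) (n1 : ν 1 < 0) (n2 : ν 2 < 0)
    (hdef : ¬ ∀ i, μ i + μ (i + 1) < 0)
    (h0 : milnorRatio ν 0 = k * milnorRatio μ 0)
    (hs : milnorRatio ν 0 + milnorRatio ν 1 + milnorRatio ν 2 =
      k * (milnorRatio μ 0 + milnorRatio μ 1 + milnorRatio μ 2))
    (hp : milnorRatio ν 0 * milnorRatio ν 1 * milnorRatio ν 2 =
      k ^ 3 * (milnorRatio μ 0 * milnorRatio μ 1 * milnorRatio μ 2)) : k = 1 := by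
  have hμ : ∀ i, μ i ≠ 0 := by
    intro i; fin_cases i; exacts [m0.ne', m1.ne, m2.ne]
  have hν : ∀ i, ν i ≠ 0 := by
    intro i; fin_cases i; exacts [n0.ne', n1.ne, n2.ne]
  have y0 : milnorRatio μ 0 < 0 := div_neg_of_neg_of_pos (add_neg m1 m2) m0
  have x0 : milnorRatio ν 0 < 0 := div_neg_of_neg_of_pos (add_neg n1 n2) n0
  have hk : 0 < k := by
    by_contra hk
    nlinarith [mul_nonneg_of_nonpos_of_nonpos (not_lt.1 hk) y0.le]
  have P := milnorRatio_prod hμ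
  have P' := milnorRatio_prod hν
  have M := mul_one_add_milnorRatio hμ
  have N := mul_one_add_milnorRatio hν
  rcases scale_dichotomy P (by rw [← hp, P', hs]) with h | h
  · exact h
  have l1 : μ 2 + μ 0 = milnorRatio μ 1 * μ 1 := (div_mul_cancel₀ _ (hμ 1)).symm
  have l2 : μ 0 + μ 1 = milnorRatio μ 2 * μ 2 := (div_mul_cancel₀ _ (hμ 2)).symm
  have M0 := M 0
  have M1 := M 1
  have M2 := M 2
  have N0 := N 0
  have N1 := N 1
  have N2 := N 2
  generalize milnorRatio μ 0 = Y0 at *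
  generalize milnorRatio μ 1 = Y1 at *
  generalize milnorRatio μ 2 = Y2 at *
  generalize milnorRatio ν 0 = X0 at *
  generalize milnorRatio ν 1 = X1 at *
  generalize milnorRatio ν 2 = X2 at *
  have ha : Y0 * Y1 * Y2 < 0 := by
    by_contra hc
    have := mul_nonneg (not_lt.1 hc) (by positivity : 0 ≤ k ^ 2 + k)
    linarith
  have hy12 : 0 < Y1 * Y2 := by
    by_contra hc
    have := mul_nonneg_of_nonpos_of_nonpos y0.le (not_lt.1 hc)
    rw [← mul_assoc] at this
    linarith
  have hy : Y1 < 0 ∧ Y2 < 0 := by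
    rcases mul_pos_iff.1 hy12 with ⟨a, b⟩ | hh
    -- Positive Y1 and Y2 would make every structure constant negative, the so(3) case.
    · refine absurd ?_ hdef
      intro i
      fin_cases i
      · change μ 0 + μ 1 < 0
        rw [l2]; exact mul_neg_of_pos_of_neg b m2
      · change μ 1 + μ 2 < 0
        linarith
      · change μ 2 + μ 0 < 0
        rw [l1]; exact mul_neg_of_pos_of_neg a m1
    · exact hh
  subst h0
  -- After removal of X0 = k Y0, the pairs X1, X2 and k Y1, k Y2 have equal sum and product, so they
  -- agree up to order.
  have hs' : X1 + X2 = k * (Y1 + Y2) := by linarith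
  have hp' : X1 * X2 = (k * Y1) * (k * Y2) := by
    have : (k * Y0) * (X1 * X2 - (k * Y1) * (k * Y2)) = 0 := by linarith
    rcases mul_eq_zero.1 this with h | h
    · exact absurd h x0.ne
    · linarith
  have hroot : (X1 - k * Y1) * (X1 - k * Y2) = 0 := by
    have : X2 = k * (Y1 + Y2) - X1 := by linarith
    subst this
    linarith
  rcases mul_eq_zero.1 hroot with h1 | h1
  · have e1 : X1 = k * Y1 := by linarith
    have e2 : X2 = k * Y2 := by linarith
    subst e1 e2
    exact scale_eq_one_of_separated (z₀ := -Y0) (z₁ := -Y1) (z₂ := -Y2) (m₀ := μ 0) (m₁ := μ 1)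
      (m₂ := μ 2) (n₀ := ν 0) (n₁ := ν 1) (n₂ := ν 2) hk (by linarith) (by linarith) (by linarith)
      (by linarith) (by linarith) m0 m1 m2 n0 n1 n2 (by linarith) (by linarith) (by linarith)
      (by linarith)
  · have e1 : X1 = k * Y2 := by linarith
    have e2 : X2 = k * Y1 := by linarith
    subst e1 e2
    exact scale_eq_one_of_separated (z₀ := -Y0) (z₁ := -Y1) (z₂ := -Y2) (m₀ := μ 0) (m₁ := μ 1)
      (m₂ := μ 2) (n₀ := ν 0) (n₁ := ν 2) (n₂ := ν 1) hk (by linarith) (by linarith) (by linarith)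
      (by linarith) (by linarith) m0 m1 m2 n0 n2 n1 (by linarith) (by linarith) (by linarith)
      (by linarith)

theorem scale_eq_one_of_pos {μ ν : Fin 3 → ℝ} {k : ℝ} (hμ : ∀ i, 0 < μ i) (hν : ∀ i, 0 < ν i)
    (hs : milnorRatio ν 0 + milnorRatio ν 1 + milnorRatio ν 2 =
      k * (milnorRatio μ 0 + milnorRatio μ 1 + milnorRatio μ 2))
    (hp : milnorRatio ν 0 * milnorRatio ν 1 * milnorRatio ν 2 =
      k ^ 3 * (milnorRatio μ 0 * milnorRatio μ 1 * milnorRatio μ 2)) : k = 1 := by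
  have P := milnorRatio_prod fun i ↦ (hμ i).ne'
  have P' := milnorRatio_prod fun i ↦ (hν i).ne'
  have hy : ∀ i, 0 < milnorRatio μ i := fun i ↦ div_pos (add_pos (hμ _) (hμ _)) (hμ _)
  have hx : ∀ i, 0 < milnorRatio ν i := fun i ↦ div_pos (add_pos (hν _) (hν _)) (hν _)
  have hk : 0 < k := by
    by_contra hk
    have := mul_nonpos_of_nonpos_of_nonneg (not_lt.1 hk) (add_pos (add_pos (hy 0) (hy 1)) (hy 2)).le
    linarith [hx 0, hx 1, hx 2]
  rcases scale_dichotomy P (by rw [← hp, P', hs]) with h | h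
  · exact h
  · have := mul_pos (mul_pos (mul_pos (hy 0) (hy 1)) (hy 2)) (by positivity : 0 < k ^ 2 + k)
    linarith

end Scalar
end LeftInvariantRicci

namespace LeftInvariantRicci
open Module Matrix

/-! ### Change of Milnor frame -/

section Transition

/-- `A` transforms the Milnor data `μ` into the Milnor data `ν`, up to the factor `t` of the
Ricci forms. -/
structure IsMilnorTransition (A : Matrix (Fin 3) (Fin 3) ℝ) (t : ℝ) (μ ν : Fin 3 → ℝ) : Prop where
  det_ne_zero : A.det ≠ 0
  bracket : ∀ j k, (A (k + 1) j * A (k + 2) (j + 1) - A (k + 2) j * A (k + 1) (j + 1)) *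
    (μ (k + 1) + μ (k + 2)) = (ν j + ν (j + 1)) * A k (j + 2)
  ricci : ∀ i j, t * ∑ k, A k i * A k j * (2 * μ (k + 1) * μ (k + 2)) =
    if i = j then 2 * ν (i + 1) * ν (i + 2) else 0

variable {A : Matrix (Fin 3) (Fin 3) ℝ} {t : ℝ} {μ ν : Fin 3 → ℝ}

theorem IsMilnorTransition.ricci_matrix (h : IsMilnorTransition A t μ ν) :
    t • (Aᵀ * diagonal (fun k ↦ 2 * μ (k + 1) * μ (k + 2)) * A) =
      diagonal fun k ↦ 2 * ν (k + 1) * ν (k + 2) := by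
  ext i j
  rw [diagonal_apply, ← h.ricci i j]
  simp only [Matrix.smul_apply, Matrix.mul_apply (M := Aᵀ * _), Matrix.mul_diagonal,
    transpose_apply, smul_eq_mul]
  congr 1
  exact Finset.sum_congr rfl fun k _ ↦ by ring

/-- Brackets transform through the cofactors of A; multiplying by Aᵀ turns the adjugate into det A.
-/
theorem IsMilnorTransition.bracket_matrix (h : IsMilnorTransition A t μ ν) :
    A.det • diagonal (fun k ↦ μ (k + 1) + μ (k + 2)) =
      A * diagonal (fun k ↦ ν (k + 1) + ν (k + 2)) * Aᵀ := by
  have h1 : diagonal (fun k ↦ μ (k + 1) + μ (k + 2)) * A.adjugateᵀ =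
      A * diagonal (fun k ↦ ν (k + 1) + ν (k + 2)) := by
    ext k j
    have hb := h.bracket (j + 1) k
    have a1 : ∀ i : Fin 3, i + 1 + 1 = i + 2 := by decide
    have a2 : ∀ i : Fin 3, i + 1 + 2 = i := by decide
    rw [a1, a2] at hb
    rw [Matrix.diagonal_mul, Matrix.mul_diagonal, mul_comm (A k j), ← hb, mul_comm, transpose_apply,
      adjugate_fin_three]
    congr 1
    fin_cases k <;> fin_cases j <;> simp <;> ring
  have h2 : A.adjugateᵀ * Aᵀ = A.det • (1 : Matrix (Fin 3) (Fin 3) ℝ) := by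
    rw [← transpose_mul, mul_adjugate, transpose_smul, transpose_one]
  rw [← h1, mul_assoc, h2, mul_smul_comm, mul_one]

/-- The bracket relation carries Aᵀ on the right and the Ricci relation carries it on the left;
composing them eliminates it and leaves a similarity. -/
theorem IsMilnorTransition.intertwine (h : IsMilnorTransition A t μ ν) (i j : Fin 3) :
    A i j * ((ν (j + 1) + ν (j + 2)) * (2 * ν (j + 1) * ν (j + 2))) =
      t * A.det * ((μ (i + 1) + μ (i + 2)) * (2 * μ (i + 1) * μ (i + 2))) * A i j := by
  have : A * diagonal (fun k ↦ ν (k + 1) + ν (k + 2)) *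
      diagonal (fun k ↦ 2 * ν (k + 1) * ν (k + 2)) =
      (t * A.det) • (diagonal (fun k ↦ μ (k + 1) + μ (k + 2)) *
        diagonal (fun k ↦ 2 * μ (k + 1) * μ (k + 2)) * A) := by
    rw [← h.ricci_matrix, mul_smul_comm, mul_smul, ← smul_mul_assoc A.det, ← smul_mul_assoc A.det,
      h.bracket_matrix]
    simp only [mul_assoc]
  have := congrFun (congrFun this i) j
  simp only [Matrix.mul_diagonal, Matrix.smul_apply, diagonal_mul_diagonal, Matrix.diagonal_mul,
    smul_eq_mul] at this
  linarith

theorem IsMilnorTransition.det_sq (h : IsMilnorTransition A t μ ν) :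
    (ν 0 * ν 1 * ν 2) ^ 2 = t ^ 3 * A.det ^ 2 * (μ 0 * μ 1 * μ 2) ^ 2 := by
  have := congrArg det h.ricci_matrix
  rw [det_smul, det_mul, det_mul, det_transpose, det_diagonal, det_diagonal, Fin.prod_univ_three,
    Fin.prod_univ_three] at this
  have e1 : (1 : Fin 3) + 1 = 2 := rfl
  have e2 : (1 : Fin 3) + 2 = 0 := rfl
  have e3 : (2 : Fin 3) + 1 = 0 := rfl
  have e4 : (2 : Fin 3) + 2 = 1 := rfl
  simp only [zero_add, e1, e2, e3, e4, Fintype.card_fin] at this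
  linarith

/-- The scale factor between the two families of Milnor ratios. -/
theorem IsMilnorTransition.exists_scale (h : IsMilnorTransition A t μ ν) (ht : 0 < t)
    (hμ : ∀ i, μ i ≠ 0) (hν : ∀ i, ν i ≠ 0) :
    ∃ k : ℝ, (k = 1 → t = 1) ∧
      (∀ i j, A i j ≠ 0 → milnorRatio ν j = k * milnorRatio μ i) ∧
      milnorRatio ν 0 + milnorRatio ν 1 + milnorRatio ν 2 =
        k * (milnorRatio μ 0 + milnorRatio μ 1 + milnorRatio μ 2) ∧
      milnorRatio ν 0 * milnorRatio ν 1 * milnorRatio ν 2 =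
        k ^ 3 * (milnorRatio μ 0 * milnorRatio μ 1 * milnorRatio μ 2) := by
  have hp : μ 0 * μ 1 * μ 2 ≠ 0 := mul_ne_zero (mul_ne_zero (hμ 0) (hμ 1)) (hμ 2)
  have hq : ν 0 * ν 1 * ν 2 ≠ 0 := mul_ne_zero (mul_ne_zero (hν 0) (hν 1)) (hν 2)
  have hd := h.det_sq
  have hratio : ∀ (α : Fin 3 → ℝ), (∀ i, α i ≠ 0) → ∀ i,
      (α (i + 1) + α (i + 2)) * (2 * α (i + 1) * α (i + 2)) =
        2 * (α 0 * α 1 * α 2) * milnorRatio α i := by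
    intro α hα i
    have h1 : α 0 * α 1 * α 2 = α i * α (i + 1) * α (i + 2) := by
      fin_cases i
      · rfl
      · change _ = α 1 * α 2 * α 0; ring
      · change _ = α 2 * α 0 * α 1; ring
    rw [h1, milnorRatio]
    have := hα i
    field_simp
  set p := μ 0 * μ 1 * μ 2
  set q := ν 0 * ν 1 * ν 2
  have hk : ∀ i j, A i j * milnorRatio ν j = t * A.det * p / q * milnorRatio μ i * A i j := by
    intro i j
    have := h.intertwine i j
    rw [hratio μ hμ, hratio ν hν] at this
    field_simp
    linarith
  have hM : A * diagonal (milnorRatio ν) = (t * A.det * p / q) • (diagonal (milnorRatio μ) * A) := by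
    ext i j
    simp only [Matrix.mul_diagonal, Matrix.smul_apply, Matrix.diagonal_mul, smul_eq_mul]
    rw [hk]; ring
  refine ⟨t * A.det * p / q, fun h1 ↦ ?_, fun i j hij ↦ ?_, ?_, ?_⟩
  -- k = 1 means q = t det A p; with q² = t³ (det A)² p² this yields t² = t³.
  · rw [div_eq_one_iff_eq hq] at h1
    rw [← h1] at hd
    have h2 : (t ^ 2 * A.det ^ 2 * p ^ 2) * (t - 1) = 0 := by linarith
    rcases mul_eq_zero.1 h2 with h3 | h3
    · have : t ^ 2 * A.det ^ 2 * p ^ 2 ≠ 0 :=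
        mul_ne_zero (mul_ne_zero (pow_ne_zero _ ht.ne') (pow_ne_zero _ h.det_ne_zero))
          (pow_ne_zero _ hp)
      exact absurd h3 this
    · linarith
  · have := hk i j
    exact mul_left_cancel₀ hij (by linarith)
  · have hu : IsUnit A.det := isUnit_iff_ne_zero.2 h.det_ne_zero
    have h1 : diagonal (milnorRatio ν) =
        (t * A.det * p / q) • (A⁻¹ * (diagonal (milnorRatio μ) * A)) := by
      rw [← mul_smul_comm, ← hM, ← mul_assoc, nonsing_inv_mul _ hu, one_mul]
    have h2 := congrArg trace h1
    rw [trace_smul, trace_mul_comm, mul_assoc (diagonal _), mul_nonsing_inv _ hu, mul_one,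
      trace_diagonal, trace_diagonal, Fin.sum_univ_three, Fin.sum_univ_three] at h2
    exact h2
  · have h1 := congrArg det hM
    rw [det_smul, det_mul, det_mul, det_diagonal, det_diagonal, Fin.prod_univ_three,
      Fin.prod_univ_three, Fintype.card_fin] at h1
    exact mul_left_cancel₀ h.det_ne_zero (by linarith)

/-- In both frames the vectors 1 and 2 span the radical of the Ricci form, so A 0 1 = A 0 2 = 0.
Bracketing with vector 0, compressed to this plane, has determinant μ 1 * μ 2, which changes by A 0
0 ^ 2, whereas the Ricci entry changes by t * A 0 0 ^ 2. -/
theorem IsMilnorTransition.eq_one_of_zero (h : IsMilnorTransition A t μ ν) (ht : 0 < t)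
    (hμ : μ 0 = 0) (hμ1 : μ 1 ≠ 0) (hμ2 : μ 2 ≠ 0) (hν : ν 0 = 0) :
    t = 1 := by
  have e1 : (1 : Fin 3) + 1 = 2 := rfl
  have e2 : (1 : Fin 3) + 2 = 0 := rfl
  have e3 : (2 : Fin 3) + 1 = 0 := rfl
  have e4 : (2 : Fin 3) + 2 = 1 := rfl
  have r00 := h.ricci 0 0
  have r11 := h.ricci 1 1
  have r22 := h.ricci 2 2
  have b11 := h.bracket 2 1
  have b12 := h.bracket 2 2
  have b21 := h.bracket 0 1
  have b22 := h.bracket 0 2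
  have hdet := h.det_ne_zero
  rw [det_fin_three] at hdet
  simp only [Fin.sum_univ_three, zero_add, e1, e2, e3, e4, hμ, hν, if_true, mul_zero, zero_mul,
    add_zero] at r00 r11 r22 b11 b12 b21 b22
  have hz : ∀ a, t * (a * a * (2 * μ 1 * μ 2)) = 0 → a = 0 := by
    intro a ha
    simpa [ht.ne', hμ1, hμ2] using ha
  have A01 := hz _ r11
  have A02 := hz _ r22
  simp only [A01, A02, mul_zero, zero_mul, sub_zero, zero_sub, add_zero] at b11 b12 b21 b22 hdet
  have hm : A 0 0 * (A 1 1 * A 2 2 - A 1 2 * A 2 1) ≠ 0 := by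
    intro h0; apply hdet; linarith
  have hA := left_ne_zero_of_mul hm
  have hm' := right_ne_zero_of_mul hm
  have key : (A 1 1 * A 2 2 - A 1 2 * A 2 1) * (ν 1 * ν 2 - A 0 0 ^ 2 * (μ 1 * μ 2)) = 0 := by
    have k1 : (ν 2 * A 1 1) * (ν 1 * A 2 2) = (A 2 2 * A 0 0 * μ 2) * (A 0 0 * A 1 1 * μ 1) := by
      rw [← b11, ← b22]
    have k2 : (ν 2 * A 2 1) * (ν 1 * A 1 2) =
        (-(A 1 2 * A 0 0) * μ 1) * (-(A 0 0 * A 2 1) * μ 2) := by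
      rw [← b12, ← b21]
    linear_combination k1 - k2
  have h1 : ν 1 * ν 2 = A 0 0 ^ 2 * (μ 1 * μ 2) := by
    rcases mul_eq_zero.1 key with h | h
    · exact absurd h hm'
    · linarith
  have h2 : (t - 1) * (A 0 0 ^ 2 * (μ 1 * μ 2)) = 0 := by linarith
  rcases mul_eq_zero.1 h2 with h | h
  · linarith
  · exact absurd h (mul_ne_zero (pow_ne_zero _ hA) (mul_ne_zero hμ1 hμ2))

/-- A positive definite Ricci form has no negative diagonal entry in any frame; this keeps the
patterns (+,+,+) and (+,-,-) apart. -/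
theorem IsMilnorTransition.ricci_one_nonneg (h : IsMilnorTransition A t μ ν) (ht : 0 < t)
    (hμ : ∀ i, 0 < μ i) : 0 ≤ ν 2 * ν 0 := by
  have r : _ = 2 * ν 2 * ν 0 := h.ricci 1 1
  have : 0 ≤ 2 * ν 2 * ν 0 := by
    rw [← r]
    exact mul_nonneg ht.le (Finset.sum_nonneg fun k _ ↦ mul_nonneg (mul_self_nonneg _)
      (mul_nonneg (mul_nonneg zero_le_two (hμ _).le) (hμ _).le))
  linarith

/-- Otherwise the vector 0 of the new frame would lie in the plane where the form is negative.
Consequently the ratios of index 0 correspond to each other. -/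
theorem IsMilnorTransition.apply_zero_zero_ne_zero (h : IsMilnorTransition A t μ ν) (ht : 0 < t)
    (m0 : 0 < μ 0) (m1 : μ 1 < 0) (m2 : μ 2 < 0) (hν : 0 < ν 1 * ν 2) : A 0 0 ≠ 0 := by
  intro h0
  have r : _ = 2 * ν 1 * ν 2 := h.ricci 0 0
  have : t * ∑ k, A k 0 * A k 0 * (2 * μ (k + 1) * μ (k + 2)) ≤ 0 := by
    refine mul_nonpos_of_nonneg_of_nonpos ht.le (Finset.sum_nonpos fun k _ ↦ ?_)
    fin_cases k
    · simp [h0]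
    · refine mul_nonpos_of_nonneg_of_nonpos (mul_self_nonneg _) ?_
      change 2 * μ 2 * μ 0 ≤ 0
      have := mul_neg_of_neg_of_pos m2 m0
      linarith
    · refine mul_nonpos_of_nonneg_of_nonpos (mul_self_nonneg _) ?_
      change 2 * μ 0 * μ 1 ≤ 0
      have := mul_neg_of_pos_of_neg m0 m1
      linarith
  linarith

end Transition

/-! ### Normal forms of frames and uniqueness of the constant -/

section Frames
variable {𝔤 : Type*} [LieRing 𝔤] [LieAlgebra ℝ 𝔤] {e f : Basis (Fin 3) ℝ 𝔤} {μ ν : Fin 3 → ℝ}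
  {B T : LinearMap.BilinForm ℝ 𝔤}

theorem IsMilnorFrame.transition (he : IsMilnorFrame e μ) (hf : IsMilnorFrame f ν) {c d : ℝ}
    (hc : 0 < c) (hTe : IsMilnorRicci e μ (c • T)) (hTf : IsMilnorRicci f ν (d • T)) :
    IsMilnorTransition (e.toMatrix f) (d / c) μ ν where
  det_ne_zero := by
    have := e.toMatrix_mul_toMatrix_flip f
    have := congrArg det this
    rw [det_mul, det_one] at this
    exact left_ne_zero_of_mul (this ▸ one_ne_zero)
  bracket := by
    intro j k
    have hS : ∀ i, ⁅e (i + 1), e (i + 2)⁆ = (μ (i + 1) + μ (i + 2)) • e i := by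
      intro i
      have hb := he (i + 1)
      rwa [show i + 1 + 1 = i + 2 by fin_cases i <;> rfl,
        show i + 1 + 2 = i by fin_cases i <;> rfl] at hb
    have h1 := lie_sum_basis e _ hS (fun i ↦ e.toMatrix f i j) (fun i ↦ e.toMatrix f i (j + 1))
    simp only [e.sum_toMatrix_smul_self, hf j, smul_smul] at h1
    have h2 := congrArg (fun x ↦ e.repr x k) h1
    simp only [map_smul, map_sum, Finsupp.smul_apply, Finsupp.coe_finsetSum, Finset.sum_apply,
      Basis.repr_self, Finsupp.single_apply, smul_eq_mul, mul_ite, mul_one, mul_zero,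
      Finset.sum_ite_eq', Finset.mem_univ, if_true] at h2
    rw [Basis.toMatrix_apply e f k, h2]
  ricci := by
    intro i j
    rw [← hTf i j]
    conv_rhs => rw [← e.sum_toMatrix_smul_self f i, ← e.sum_toMatrix_smul_self f j]
    have hTe' : ∀ i j, T (e i) (e j) = if i = j then (2 * μ (i + 1) * μ (i + 2)) / c else 0 := by
      intro i j
      have := hTe i j
      simp only [LinearMap.smul_apply, smul_eq_mul] at this
      split_ifs at this ⊢ with hij
      · field_simp; linarith
      · simpa [hc.ne'] using this
    simp only [map_sum, map_smul, LinearMap.smul_apply, LinearMap.sum_apply, smul_eq_mul, hTe',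
      mul_ite, mul_zero, Finset.sum_ite_eq', Finset.mem_univ, if_true,
      Finset.mul_sum]
    exact Finset.sum_congr rfl fun k _ ↦ by field_simp

/-- Structure constants are odd under e ↦ -e, while Ricci entries are quadratic in μ. -/
theorem IsMilnorFrame.neg (he : IsMilnorFrame e μ) (hB : IsMilnorRicci e μ B) :
    ∃ e' : Basis (Fin 3) ℝ 𝔤, IsMilnorFrame e' (-μ) ∧ IsMilnorRicci e' (-μ) B := by
  refine ⟨e.map (LinearEquiv.neg ℝ), fun i ↦ ?_, fun i j ↦ ?_⟩
  · simp [he i]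
    module
  · simp [hB i j]

theorem IsMilnorFrame.rotate (he : IsMilnorFrame e μ) (hB : IsMilnorRicci e μ B) (a : Fin 3) :
    ∃ e' : Basis (Fin 3) ℝ 𝔤, IsMilnorFrame e' (fun i ↦ μ (i + a)) ∧
      IsMilnorRicci e' (fun i ↦ μ (i + a)) B := by
  refine ⟨e.reindex (Equiv.subRight a), fun i ↦ ?_, fun i j ↦ ?_⟩
  · have := he (i + a)
    simp only [Basis.reindex_apply, Equiv.subRight_symm_apply]
    rwa [add_right_comm i 1 a, add_right_comm i 2 a]
  · have := hB (i + a) (j + a)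
    simp only [Basis.reindex_apply, Equiv.subRight_symm_apply]
    rw [this, add_right_comm i 1 a, add_right_comm i 2 a]
    simp

theorem IsMilnorRicci.eq_zero (hB : IsMilnorRicci e μ B) (h : ∀ i, μ (i + 1) * μ (i + 2) = 0) :
    B = 0 := by
  refine e.ext fun i ↦ e.ext fun j ↦ ?_
  rw [hB i j, mul_assoc, h]
  simp

theorem IsMilnorFrame.normalize_of_pos (he : IsMilnorFrame e μ) (hB : IsMilnorRicci e μ B)
    (hp : 0 < μ 0 * μ 1 * μ 2) :
    ∃ (e' : Basis (Fin 3) ℝ 𝔤) (μ' : Fin 3 → ℝ), IsMilnorFrame e' μ' ∧ IsMilnorRicci e' μ' B ∧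
      ((∀ i, 0 < μ' i) ∨ (0 < μ' 0 ∧ μ' 1 < 0 ∧ μ' 2 < 0)) := by
  have key : (∀ i, 0 < μ i) ∨ ∃ a, 0 < μ a ∧ μ (1 + a) < 0 ∧ μ (2 + a) < 0 := by
    rcases mul_pos_iff.1 hp with ⟨h, h2⟩ | ⟨h, h2⟩
    · rcases mul_pos_iff.1 h with ⟨h0, h1⟩ | ⟨h0, h1⟩
      · left; intro i; fin_cases i; exacts [h0, h1, h2]
      · exact .inr ⟨2, h2, h0, h1⟩
    · rcases mul_neg_iff.1 h with ⟨h0, h1⟩ | ⟨h0, h1⟩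
      · exact .inr ⟨0, h0, h1, h2⟩
      · exact .inr ⟨1, h1, h2, h0⟩
  rcases key with h | ⟨a, h0, h1, h2⟩
  · exact ⟨e, μ, he, hB, .inl h⟩
  · obtain ⟨e', he', hB'⟩ := he.rotate hB a
    exact ⟨e', _, he', hB', .inr ⟨by simpa using h0, h1, h2⟩⟩

/-- A negative product is made positive by negation, and then one or three of the μ are positive. If
the product vanishes, a zero is rotated to index 0, and B ≠ 0 excludes a second zero. -/
theorem IsMilnorFrame.normalize (he : IsMilnorFrame e μ) (hB : IsMilnorRicci e μ B)
    (hB0 : B ≠ 0) :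
    ∃ (e' : Basis (Fin 3) ℝ 𝔤) (μ' : Fin 3 → ℝ), IsMilnorFrame e' μ' ∧ IsMilnorRicci e' μ' B ∧
      ((∀ i, 0 < μ' i) ∨ (0 < μ' 0 ∧ μ' 1 < 0 ∧ μ' 2 < 0) ∨ (μ' 0 = 0 ∧ μ' 1 ≠ 0 ∧ μ' 2 ≠ 0)) := by
  rcases lt_trichotomy (μ 0 * μ 1 * μ 2) 0 with hp | hp | hp
  · obtain ⟨e₁, he₁, hB₁⟩ := he.neg hB
    obtain ⟨e', μ', he', hB', h⟩ := he₁.normalize_of_pos hB₁ (by simp; linarith)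
    exact ⟨e', μ', he', hB', h.imp_right .inl⟩
  · have ha : ∃ a, μ a = 0 := by
      simp only [mul_eq_zero] at hp
      tauto
    obtain ⟨a, ha⟩ := ha
    obtain ⟨e', he', hB'⟩ := he.rotate hB a
    have h0 : μ (0 + a) = 0 := by simpa using ha
    have h12 : μ (1 + a) * μ (2 + a) ≠ 0 := by
      intro h12
      refine hB0 (hB'.eq_zero fun i ↦ ?_)
      fin_cases i
      · exact h12
      · change μ (2 + a) * μ (0 + a) = 0
        rw [h0, mul_zero]
      · change μ (0 + a) * μ (1 + a) = 0
        rw [h0, zero_mul]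
    exact ⟨e', _, he', hB', .inr (.inr ⟨h0, left_ne_zero_of_mul h12, right_ne_zero_of_mul h12⟩)⟩
  · obtain ⟨e', μ', he', hB', h⟩ := he.normalize_of_pos hB hp
    exact ⟨e', μ', he', hB', h.imp_right .inl⟩

theorem IsMilnorRicci.sigPos_sigNeg {c : ℝ} (hc : 0 < c) (hT : IsMilnorRicci e μ (c • T))
    (m0 : 0 < μ 0) (m1 : μ 1 < 0) (m2 : μ 2 < 0) :
    sigPos (LinearMap.BilinMap.toQuadraticMap T) = 1 ∧
      sigNeg (LinearMap.BilinMap.toQuadraticMap T) = 2 := by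
  have hT' : ∀ i j, c * T (e i) (e j) = if i = j then 2 * μ (i + 1) * μ (i + 2) else 0 := hT
  have h0 : c * T (e 0) (e 0) = 2 * μ 1 * μ 2 := hT' 0 0
  have h1 : c * T (e 1) (e 1) = 2 * μ 2 * μ 0 := hT' 1 1
  have h2 : c * T (e 2) (e 2) = 2 * μ 0 * μ 1 := hT' 2 2
  refine sigPos_sigNeg_of_diagonal T e (fun i j hij ↦ ?_) ?_ ?_ ?_
  · have := hT' i j
    rw [if_neg hij] at this
    exact (mul_eq_zero.1 this).resolve_left hc.ne'
  · refine pos_of_mul_pos_right (a := c) ?_ hc.le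
    rw [h0]
    have := mul_pos_of_neg_of_neg m1 m2
    linarith
  · refine neg_of_mul_neg_right (a := c) ?_ hc.le
    rw [h1]
    have := mul_neg_of_neg_of_pos m2 m0
    linarith
  · refine neg_of_mul_neg_right (a := c) ?_ hc.le
    rw [h2]
    have := mul_neg_of_pos_of_neg m0 m1
    linarith

/-- If the Ricci forms of two Milnor frames are positive multiples `c T` and `d T` of the same form
`T ≠ 0`, then `c = d`, unless `T` has signature `(+,-,-)` on `so(3)`. -/
theorem IsMilnorFrame.ricci_const_unique (he : IsMilnorFrame e μ) (hf : IsMilnorFrame f ν)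
    {c d : ℝ} (hc : 0 < c) (hd : 0 < d) (hTe : IsMilnorRicci e μ (c • T))
    (hTf : IsMilnorRicci f ν (d • T)) (hT : T ≠ 0)
    (hex : ¬ ((sigPos (LinearMap.BilinMap.toQuadraticMap T) = 1 ∧
      sigNeg (LinearMap.BilinMap.toQuadraticMap T) = 2) ∧
      Nonempty (𝔤 ≃ₗ⁅ℝ⁆ LieAlgebra.Orthogonal.so (Fin 3) ℝ))) : c = d := by
  obtain ⟨e, μ, he, hTe, hμ⟩ := he.normalize hTe (smul_ne_zero hc.ne' hT)
  obtain ⟨f, ν, hf, hTf, hν⟩ := hf.normalize hTf (smul_ne_zero hd.ne' hT)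
  have htr := he.transition hf hc hTe hTf
  have ht : 0 < d / c := div_pos hd hc
  have htr' := hf.transition he hd hTf hTe
  have ht' : 0 < c / d := div_pos hc hd
  suffices d / c = 1 by rw [div_eq_one_iff_eq hc.ne'] at this; exact this.symm
  have hdet := htr.det_sq
  -- The degenerate case occurs in both frames or in neither, since t and det A are nonzero.
  have hzero : μ 0 * μ 1 * μ 2 = 0 ↔ ν 0 * ν 1 * ν 2 = 0 := by
    constructor
    · intro h; rw [h] at hdet; simpa using hdet
    · intro h; rw [h] at hdet
      simpa [ht.ne', htr.det_ne_zero, hc.ne', hd.ne'] using hdet.symm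
  have nz : ∀ {α : Fin 3 → ℝ}, ((∀ i, 0 < α i) ∨ (0 < α 0 ∧ α 1 < 0 ∧ α 2 < 0)) → ∀ i, α i ≠ 0 := by
    rintro α (h | ⟨h0, h1, h2⟩) i
    · exact (h i).ne'
    · fin_cases i; exacts [h0.ne', h1.ne, h2.ne]
  have nz' : ∀ {α : Fin 3 → ℝ}, ((∀ i, 0 < α i) ∨ (0 < α 0 ∧ α 1 < 0 ∧ α 2 < 0)) →
      α 0 * α 1 * α 2 ≠ 0 := fun h ↦ mul_ne_zero (mul_ne_zero (nz h 0) (nz h 1)) (nz h 2)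
  rw [← or_assoc] at hμ hν
  rcases hμ with hμ | ⟨μ0, μ1, μ2⟩
  · rcases hν with hν | ⟨ν0, -, -⟩
    swap
    · exact absurd (hzero.2 (by simp [ν0])) (nz' hμ)
    obtain ⟨k, hk, hA, hs, hp⟩ := htr.exists_scale ht (nz hμ) (nz hν)
    refine hk ?_
    rcases hμ with hμ | ⟨m0, m1, m2⟩
    · rcases hν with hν | ⟨n0, n1, n2⟩
      · exact scale_eq_one_of_pos hμ hν hs hp
      · exact absurd (htr.ricci_one_nonneg ht hμ) (not_le.2 (mul_neg_of_neg_of_pos n2 n0))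
    · rcases hν with hν | ⟨n0, n1, n2⟩
      · exact absurd (htr'.ricci_one_nonneg ht' hν) (not_le.2 (mul_neg_of_neg_of_pos m2 m0))
      -- Only here does the excluded case enter: the signs of μ give T signature (+,-,-), and
      -- negative structure constants would give so(3).
      · exact scale_eq_one_of_pos_neg_neg m0 m1 m2 n0 n1 n2
          (fun hdef ↦ hex ⟨hTe.sigPos_sigNeg hc m0 m1 m2, he.nonempty_lieEquiv_so hdef⟩)
          (hA 0 0 (htr.apply_zero_zero_ne_zero ht m0 m1 m2 (mul_pos_of_neg_of_neg n1 n2))) hs hp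
  · rcases hν with hν | ⟨ν0, -, -⟩
    · exact absurd (hzero.1 (by simp [μ0])) (nz' hν)
    · exact htr.eq_one_of_zero ht μ0 μ1 μ2 ν0

end Frames
end LeftInvariantRicci

theorem mainTheorem3
    {G : Type*} [TopologicalSpace G] [ChartedSpace (EuclideanSpace ℝ (Fin 3)) G] [Group G]
    [LieGroup (𝓡 3) ∞ G]
    (hG : LeftInvariantRicci.IsUnimodular (𝓡 3) G)
    (T : LeftInvariantRicci.TensorField02 (𝓡 3) G)
    (hTinv : LeftInvariantRicci.IsLeftInvariant T)
    (hTsymm : LeftInvariantRicci.IsSymmetric T)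
    (hT : ¬ (T = 0 ∨
      (LeftInvariantRicci.HasSignaturePosNegNeg T ∧ LeftInvariantRicci.IsLocallySO3 (𝓡 3) G))) :
    {c : ℝ | 0 < c ∧ ∃ g : LeftInvariantRicci.SmoothMetric (𝓡 3) G,
      LeftInvariantRicci.IsLeftInvariant (I := 𝓡 3) (G := G) g.inner ∧
      LeftInvariantRicci.HasRicciCurvature g (c • T)}.Subsingleton := by
  rintro c ⟨hc, g, hg, hgT⟩ d ⟨hd, h, hh, hhT⟩
  rw [not_or] at hT
  have h3 : Module.finrank ℝ (EuclideanSpace ℝ (Fin 3)) = 3 := by simp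
  obtain ⟨e, μ, he, hμ⟩ := LeftInvariantRicci.exists_milnorFrame_of_metric h3 hG g
  obtain ⟨f, ν, hf, hν⟩ := LeftInvariantRicci.exists_milnorFrame_of_metric h3 hG h
  refine hμ.ricci_const_unique (T := ContinuousLinearMap.toLinearMap₁₂ (T 1)) hν hc hd
    (hgT.isMilnorRicci h3 hg he hμ) (hhT.isMilnorRicci h3 hh hf hν) ?_ hT.2
  exact fun h0 ↦ hT.1 (hg.eq_zero h3 he hTinv h0)
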